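/- Let $(R,\mathfrak m)$ be a commutative Noetherian local ring and let $\mathcal S$ be a Serre class of $R$-modules, i.e. a class containing $0$ such that for every exact sequence $0\to L\to M\to N\to 0$ one has $M\in\mathcal S$ if and only if $L\in\mathcal S$ and $N\in\mathcal S$. A sequence $x_1,\dots,x_r$ in $R$ is a *weak $M$-sequence with respect to $\mathcal S$* if $\big((x_1,\dots,x_{i-1})M:_M x_i\big)/(x_1,\dots,x_{i-1})M\in\mathcal S$ for all $i=1,\dots,r$. A finitely generated $R$-module $M$ is *$\mathcal S$-Cohen–Macaulay* if every system of parameters of $M$ is a weak $M$-sequence with respect to $\mathcal S$. For an $R$-module $L$ put $$\mathcal S\text{-}\operatorname{Assh}_R L=\{\mathfrak p\in\operatorname{Supp}_R L : R/\mathfrak p\notin\mathcal S,\ \dim R/\mathfrak p=\dim L\}.$$ Proposition 3.6. Let $M$ be a finitely generated $\mathcal S$-Cohen–Macaulay $R$-module and let $x\in\mathfrak m$ be an element which is a weak $M$-sequence (of length one) with respect to $\mathcal S$. If $\mathcal S\text{-}\operatorname{Assh}_R(M/xM)\neq\emptyset$, then $M/xM$ is an $\mathcal S$-Cohen–Macaulay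 $R$-module, and $\dim (M/xM)=\dim M-1$. -/

import Mathlib

open CategoryTheory IsLocalRing

universe u

namespace SerreCM

variable {R : Type u} [CommRing R]

/-- The submodule `(x₁, …, x_{i-1}) M` of `M` (the entries of `x` strictly before the index `i`). -/
def prevSubmodule (M : Type u) [AddCommGroup M] [Module R M] {r : ℕ} (x : Fin r → R) (i : Fin r) :
    Submodule R M :=
  Ideal.span (x '' Set.Iio i) • ⊤

/-- The colon submodule `((x₁, …, x_{i-1}) M :_M xᵢ) = {m | xᵢ m ∈ (x₁, …, x_{i-1}) M}`. -/
def colonSubmodule (M : Type u) [AddCommGroup M] [Module R M] {r : ℕ} (x : Fin r → R) (i : Fin r) :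
    Submodule R M :=
  (prevSubmodule M x i).comap (LinearMap.lsmul R M (x i))

/-- `x₁, …, x_r` is a weak `M`-sequence with respect to a class `S` of `R`-modules: all the
quotients `((x₁, …, x_{i-1}) M :_M xᵢ) / (x₁, …, x_{i-1}) M` belong to `S`. -/
def IsWeakSequence (S : ObjectProperty (ModuleCat.{u} R)) (M : Type u) [AddCommGroup M] [Module R M]
    {r : ℕ} (x : Fin r → R) : Prop :=
  ∀ i : Fin r,
    S (ModuleCat.of R
      (colonSubmodule M x i ⧸ (prevSubmodule M x i).submoduleOf (colonSubmodule M x i)))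

/-- `x₁, …, x_d` is a system of parameters of the module `M` over the local ring `R`: the `xᵢ` lie
in the maximal ideal, `d = dim M`, and `M / (x₁, …, x_d) M` has finite length. -/
def IsSystemOfParameters [IsLocalRing R] (M : Type u) [AddCommGroup M] [Module R M]
    {d : ℕ} (x : Fin d → R) : Prop :=
  (∀ i, x i ∈ maximalIdeal R) ∧ Module.supportDim R M = (d : WithBot ℕ∞) ∧
    IsFiniteLength R (M ⧸ (Ideal.span (Set.range x) • ⊤ : Submodule R M))

/-- `M` is `S`-Cohen–Macaulay: it is finitely generated and every system of parameters of `M` is a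
weak `M`-sequence with respect to `S`. -/
def IsCohenMacaulay [IsLocalRing R] (S : ObjectProperty (ModuleCat.{u} R))
    (M : Type u) [AddCommGroup M] [Module R M] : Prop :=
  Module.Finite R M ∧
    ∀ (d : ℕ) (x : Fin d → R), IsSystemOfParameters M x → IsWeakSequence S M x

/-- `S-Supp L`: the primes `p` in the support of `L` with `R / p ∉ S`. -/
def supp (S : ObjectProperty (ModuleCat.{u} R)) (L : Type u) [AddCommGroup L] [Module R L] :
    Set (PrimeSpectrum R) :=
  {p | p ∈ Module.support R L ∧ ¬ S (ModuleCat.of R (R ⧸ p.asIdeal))}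

/-- `S-Assh L`: the primes `p` in `S-Supp L` with `dim L = dim (R / p)`. -/
def assh (S : ObjectProperty (ModuleCat.{u} R)) (L : Type u) [AddCommGroup L] [Module R L] :
    Set (PrimeSpectrum R) :=
  {p | p ∈ supp S L ∧ Module.supportDim R L = ringKrullDim (R ⧸ p.asIdeal)}

end SerreCM

namespace SerreCM

open scoped Pointwise

variable {R : Type u} [CommRing R]

/-! If passing to `M/xM` lowers the dimension by one, prepending `x` to a system of parameters `y`
of `M/xM` gives one of `M`, and the colon quotients of `y` on `M/xM` are images of those of `x, y`
on `M`, hence in `S`. For any `x` in the maximal ideal the dimension drops by at most one. Were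
there no drop, a prime `p` in `S`-Assh of `M/xM` would have coheight `dim M`, hence be minimal in
the support of `M` and so associated to `M`. As `x ∈ p`, `R/p` embeds in `0 :_M x`, which lies in
`S`, contradicting `R/p ∉ S`. -/

lemma prop_of_injective {S : ObjectProperty (ModuleCat.{u} R)} [S.IsClosedUnderSubobjects]
    {A B : Type u} [AddCommGroup A] [Module R A] [AddCommGroup B] [Module R B]
    (f : A →ₗ[R] B) (hf : Function.Injective f) (h : S (ModuleCat.of R B)) :
    S (ModuleCat.of R A) :=
  have : Mono (ModuleCat.ofHom f) := (ModuleCat.mono_iff_injective _).mpr hf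
  S.prop_of_mono (ModuleCat.ofHom f) h

lemma prop_of_surjective {S : ObjectProperty (ModuleCat.{u} R)} [S.IsClosedUnderQuotients]
    {A B : Type u} [AddCommGroup A] [Module R A] [AddCommGroup B] [Module R B]
    (f : A →ₗ[R] B) (hf : Function.Surjective f) (h : S (ModuleCat.of R A)) :
    S (ModuleCat.of R B) :=
  have : Epi (ModuleCat.ofHom f) := (ModuleCat.epi_iff_surjective _).mpr hf
  S.prop_of_epi (ModuleCat.ofHom f) h

/-- If `x` is a weak `M`-sequence with respect to `S`, then `R ⧸ p ∈ S` for every associated prime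
`p` of `M` that contains `x`. -/
lemma IsWeakSequence.prop_quotient_of_colon_eq {S : ObjectProperty (ModuleCat.{u} R)}
    [S.IsClosedUnderSubobjects] {M : Type u} [AddCommGroup M] [Module R M] {x : R}
    (hx : IsWeakSequence S M ![x]) {p : Ideal R} {m : M}
    (hp : p = (⊥ : Submodule R M).colon {m}) (hxp : x ∈ p) :
    S (ModuleCat.of R (R ⧸ p)) := by
  have hprev : prevSubmodule M ![x] 0 = ⊥ := by
    have : Set.Iio (0 : Fin 1) = ∅ := by ext i; simp
    simp [prevSubmodule, this]
  have hmem (r : R) : r ∈ p ↔ r • m = 0 := by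
    rw [hp, Submodule.mem_colon_singleton, Submodule.mem_bot]
  have hm : m ∈ colonSubmodule M ![x] 0 := by
    simpa [colonSubmodule, hprev] using (hmem x).mp hxp
  -- The map `r ↦ r • m` has kernel `p` even modulo `prevSubmodule`, which is zero at index `0`.
  let f := Submodule.mkQ ((prevSubmodule M ![x] 0).submoduleOf (colonSubmodule M ![x] 0)) ∘ₗ
    LinearMap.toSpanSingleton R _ ⟨m, hm⟩
  have hker : LinearMap.ker f = p := by
    ext r
    rw [hmem, LinearMap.mem_ker, LinearMap.comp_apply, Submodule.mkQ_apply,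
      Submodule.Quotient.mk_eq_zero, Submodule.submoduleOf, Submodule.mem_comap, hprev,
      Submodule.mem_bot]
    rfl
  refine prop_of_injective (p.liftQ f hker.ge) ?_ (hx 0)
  rw [← LinearMap.ker_eq_bot]
  exact Submodule.ker_liftQ_eq_bot _ _ _ hker.le

lemma supportDim_quotient_le_of_mem_associatedPrimes [IsNoetherianRing R] {M : Type*}
    [AddCommGroup M] [Module R M] {p : Ideal R} (hp : p ∈ associatedPrimes R M) :
    ringKrullDim (R ⧸ p) ≤ Module.supportDim R M := by
  obtain ⟨-, m, hm⟩ := isAssociatedPrime_iff.mp hp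
  have hker : LinearMap.ker (LinearMap.toSpanSingleton R M m) = p := by
    ext r
    simp [hm, Submodule.mem_colon_singleton]
  rw [← Module.supportDim_quotient_eq_ringKrullDim]
  refine Module.supportDim_le_of_injective (p.liftQ _ hker.ge) ?_
  rw [← LinearMap.ker_eq_bot]
  exact Submodule.ker_liftQ_eq_bot _ _ _ hker.le

lemma exists_ringKrullDim_quotient_eq_natCast [IsNoetherianRing R] [IsLocalRing R] (p : Ideal R)
    [p.IsPrime] : ∃ n : ℕ, ringKrullDim (R ⧸ p) = n := by
  have : IsLocalRing (R ⧸ p) := .of_surjective' (Ideal.Quotient.mk p) Ideal.Quotient.mk_surjective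
  have htop := ringKrullDim_ne_top (R := R ⧸ p)
  obtain ⟨a, ha⟩ := WithBot.ne_bot_iff_exists.mp (ringKrullDim_ne_bot (R := R ⧸ p))
  rw [← ha] at htop ⊢
  obtain ⟨n, rfl⟩ := ENat.ne_top_iff_exists.mp fun h ↦ htop (congrArg _ h)
  exact ⟨n, rfl⟩

/-- A prime of the support of `M` of coheight `dim M` is minimal in the support. -/
lemma mem_minimalPrimes_of_supportDim_eq [IsNoetherianRing R] [IsLocalRing R] {M : Type*}
    [AddCommGroup M] [Module R M] [Module.Finite R M] {p : PrimeSpectrum R}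
    (hp : p ∈ Module.support R M)
    (h : Module.supportDim R M = ringKrullDim (R ⧸ p.asIdeal)) :
    p.asIdeal ∈ (Module.annihilator R M).minimalPrimes := by
  obtain ⟨q, hq, hqp⟩ := Ideal.exists_minimalPrimes_le (Module.mem_support_iff_of_finite.mp hp)
  obtain rfl | hne := eq_or_ne q p.asIdeal
  · exact hq
  exfalso
  have := hq.isPrime
  obtain ⟨r, hrp, hrq⟩ := SetLike.exists_of_lt (lt_of_le_of_ne hqp hne)
  -- An element of `p` outside `q` is a nonzerodivisor in the domain `R/q`.
  have hlt : ringKrullDim (R ⧸ p.asIdeal) + 1 ≤ ringKrullDim (R ⧸ q) := by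
    refine ringKrullDim_succ_le_of_surjective (Ideal.Quotient.factor hqp)
      (Ideal.Quotient.factor_surjective hqp) (r := Ideal.Quotient.mk q r) ?_ ?_
    · rw [mem_nonZeroDivisors_iff_ne_zero]
      rwa [Ne, Ideal.Quotient.eq_zero_iff_mem]
    · simpa [Ideal.Quotient.eq_zero_iff_mem] using hrp
  have hle := supportDim_quotient_le_of_mem_associatedPrimes
    (Module.associatedPrimes.minimalPrimes_annihilator_subset_associatedPrimes R M hq)
  have hcon := hlt.trans (hle.trans h.le)
  -- Finiteness is essential: `d + 1 ≤ d` is no contradiction for infinite `d`.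
  obtain ⟨n, hn⟩ := exists_ringKrullDim_quotient_eq_natCast p.asIdeal
  rw [hn] at hcon
  norm_cast at hcon
  omega

lemma supportDim_quotSMulTop_succ_eq [IsNoetherianRing R] [IsLocalRing R]
    {S : ObjectProperty (ModuleCat.{u} R)} [S.IsClosedUnderSubobjects]
    {M : Type u} [AddCommGroup M] [Module R M] [Module.Finite R M]
    {x : R} (hxm : x ∈ maximalIdeal R) (hx : IsWeakSequence S M ![x])
    (hne : (assh S (QuotSMulTop x M)).Nonempty) :
    Module.supportDim R (QuotSMulTop x M) + 1 = Module.supportDim R M := by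
  refine le_antisymm ?_ (Module.supportDim_le_supportDim_quotSMulTop_succ_of_mem_jacobson ?_)
  · obtain ⟨p, ⟨hp, hpS⟩, hdim⟩ := hne
    obtain ⟨n, hn⟩ := exists_ringKrullDim_quotient_eq_natCast p.asIdeal
    rw [hdim, hn, ENat.WithBot.add_one_le_iff, ← hn, ← hdim]
    refine lt_of_le_of_ne
      (Module.supportDim_le_of_surjective _ (Submodule.mkQ_surjective _)) fun heq ↦ ?_
    rw [Module.support_quotSMulTop] at hp
    have hmin := mem_minimalPrimes_of_supportDim_eq hp.1 (heq.symm.trans hdim)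
    obtain ⟨-, m, hm⟩ := isAssociatedPrime_iff.mp
      (Module.associatedPrimes.minimalPrimes_annihilator_subset_associatedPrimes R M hmin)
    exact hpS (hx.prop_quotient_of_colon_eq hm (by simpa using hp.2))
  · refine (Module.annihilator R M).ringJacobson_le_jacobson ?_
    rwa [IsLocalRing.ringJacobson_eq_maximalIdeal]

lemma comap_mkQ_span_smul_top (M : Type*) [AddCommGroup M] [Module R M] (x : R) (s : Set R) :
    (Ideal.span s • (⊤ : Submodule R (QuotSMulTop x M))).comap
        (Submodule.mkQ (x • (⊤ : Submodule R M))) = Ideal.span (insert x s) • ⊤ := by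
  have h : (⊤ : Submodule R (QuotSMulTop x M)) =
      (⊤ : Submodule R M).map (Submodule.mkQ (x • (⊤ : Submodule R M))) := by
    rw [Submodule.map_top, Submodule.range_mkQ]
  rw [h, ← Submodule.map_smul'', Submodule.comap_map_mkQ, Ideal.span_insert, Submodule.sup_smul,
    Submodule.ideal_span_singleton_smul]

lemma comap_mkQ_prevSubmodule (M : Type u) [AddCommGroup M] [Module R M] (x : R) {d : ℕ}
    (y : Fin d → R) (i : Fin d) :
    (prevSubmodule (QuotSMulTop x M) y i).comap (Submodule.mkQ (x • (⊤ : Submodule R M))) =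
      prevSubmodule M (Fin.cons x y) i.succ := by
  have : (Fin.cons x y : Fin (d + 1) → R) '' Set.Iio i.succ = insert x (y '' Set.Iio i) := by
    ext r
    simp [Fin.exists_fin_succ, eq_comm]
  rw [prevSubmodule, prevSubmodule, comap_mkQ_span_smul_top, this]

lemma comap_mkQ_colonSubmodule (M : Type u) [AddCommGroup M] [Module R M] (x : R) {d : ℕ}
    (y : Fin d → R) (i : Fin d) :
    (colonSubmodule (QuotSMulTop x M) y i).comap (Submodule.mkQ (x • (⊤ : Submodule R M))) =
      colonSubmodule M (Fin.cons x y) i.succ := by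
  rw [colonSubmodule, colonSubmodule, ← comap_mkQ_prevSubmodule]
  rfl

/-- Both submodules for `x, y` at `i.succ` are full preimages of those for `y` at `i`, so the
projection induces a surjection of colon quotients. -/
lemma IsWeakSequence.of_cons {S : ObjectProperty (ModuleCat.{u} R)} [S.IsClosedUnderQuotients]
    {M : Type u} [AddCommGroup M] [Module R M] {x : R} {d : ℕ} {y : Fin d → R}
    (h : IsWeakSequence S M (Fin.cons x y : Fin (d + 1) → R)) :
    IsWeakSequence S (QuotSMulTop x M) y := by
  intro i
  let π := Submodule.mkQ (x • (⊤ : Submodule R M))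
  have hc := comap_mkQ_colonSubmodule M x y i
  have hp := comap_mkQ_prevSubmodule M x y i
  let f : colonSubmodule M (Fin.cons x y : Fin (d + 1) → R) i.succ →ₗ[R]
      colonSubmodule (QuotSMulTop x M) y i :=
    π.restrict fun m hm ↦ by rwa [← hc] at hm
  have hf : Function.Surjective f := by
    rintro ⟨n, hn⟩
    obtain ⟨m, rfl⟩ := Submodule.mkQ_surjective _ n
    exact ⟨⟨m, by rw [← hc]; exact hn⟩, rfl⟩
  refine prop_of_surjective (Submodule.mapQ _ _ f ?_) ?_ (h i.succ)
  · rintro ⟨m, hm⟩ hm'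
    change m ∈ prevSubmodule M _ _ at hm'
    rw [← hp] at hm'
    exact hm'
  · intro n
    obtain ⟨n, rfl⟩ := Submodule.mkQ_surjective _ n
    obtain ⟨m, rfl⟩ := hf n
    exact ⟨Submodule.mkQ _ m, rfl⟩

lemma IsSystemOfParameters.cons [IsLocalRing R] {M : Type u} [AddCommGroup M] [Module R M]
    {x : R} (hxm : x ∈ maximalIdeal R)
    (hdim : Module.supportDim R (QuotSMulTop x M) + 1 = Module.supportDim R M)
    {d : ℕ} {y : Fin d → R} (hy : IsSystemOfParameters (QuotSMulTop x M) y) :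
    IsSystemOfParameters M (Fin.cons x y : Fin (d + 1) → R) := by
  obtain ⟨hym, hyd, hyl⟩ := hy
  refine ⟨Fin.cases hxm hym, by rw [← hdim, hyd]; norm_cast, ?_⟩
  have hr := comap_mkQ_span_smul_top M x (Set.range y)
  rw [← Fin.range_cons] at hr
  rw [← hr]
  -- `M/(x, y)M` embeds in the quotient of `M/xM` by `y`, since `(x, y)M` is the full preimage.
  refine hyl.of_injective (f := Submodule.mapQ _ _ (Submodule.mkQ _) le_rfl) ?_
  rw [← LinearMap.ker_eq_bot, Submodule.mapQ, Submodule.ker_liftQ_eq_bot]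
  rw [LinearMap.ker_comp, Submodule.ker_mkQ]

end SerreCM

theorem proposition3p6 {R : Type u} [CommRing R] [IsNoetherianRing R] [IsLocalRing R]
    (S : ObjectProperty (ModuleCat.{u} R)) [S.IsSerreClass]
    (M : Type u) [AddCommGroup M] [Module R M]
    (hM : SerreCM.IsCohenMacaulay S M)
    (x : R) (hxm : x ∈ maximalIdeal R) (hx : SerreCM.IsWeakSequence S M ![x])
    (hne : (SerreCM.assh S (QuotSMulTop x M)).Nonempty) :
    SerreCM.IsCohenMacaulay S (QuotSMulTop x M) ∧
      Module.supportDim R (QuotSMulTop x M) + 1 = Module.supportDim R M := by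
  have := hM.1
  have hdim := SerreCM.supportDim_quotSMulTop_succ_eq hxm hx hne
  exact ⟨⟨inferInstance, fun d y hy ↦ (hM.2 (d + 1) _ (hy.cons hxm hdim)).of_cons⟩, hdim⟩
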